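/- Let $\Sigma$ be a finite alphabet and $\mathcal{X}$ a finite set of $n$ variables. Let $\mathcal{L}=\langle 2^{\Sigma^*},\cup,\cdot,\emptyset,\{\varepsilon\}\rangle$ be the semiring of languages and $\mathcal{P}=\langle 2^{\mathbb{N}^{\Sigma}},\cup,\dotplus,\emptyset,\{\mathbf{0}\}\rangle$ the semiring of sets of Parikh vectors, where $Z\dotplus Z'=\{z+z' : z\in Z, z'\in Z'\}$; both are ordered by inclusion. For a word $w$, $\Pi(w)\in\mathbb{N}^{\Sigma}$ counts the occurrences of each letter; $\Pi(L)=\{\Pi(w): w\in L\}$ and $\Pi^{-1}(M)=\{w\in\Sigma^*:\Pi(w)\in M\}$; both maps are applied to valuations (maps defined on $\mathcal{X}$) componentwise. Let $\mathcal{S}\in\{\mathcal{L},\mathcal{P}\}$. A polynomial over $\mathcal{S}$ is a finite expression built from coefficients in $\mathcal{S}$ and variables in $\mathcal{X}$ by the sum $\oplus$ and the product $\odot$ of $\mathcal{S}$; a polynomial transformation $F$ is a family $(F_X)_{X\in\mathcal{X}}$ of polynomials, inducing a map $F:\mathcal{S}^{\mathcal{X}}\to\mathcal{S}^{\mathcal{X}}$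 by evaluation. For a polynomial $f$, a variable $X$ and valuations $v,w$, let $D_Xf|_v(w)$ be defined by recursion on the expression: it is $0$ if $f$ is a coefficient or a variable other than $X$; it is $w(X)$ if $f=X$; $D_X(g\oplus h)|_v=D_Xg|_v\oplus D_Xh|_v$; and $D_X(g\odot h)|_v=D_Xg|_v\odot h(v)\,\oplus\, g(v)\odot D_Xh|_v$. Put $Df|_v=\bigoplus_{X\in\mathcal{X}}D_Xf|_v$, let $DF|_v$ be the componentwise differential, and $DF|_v^*(u)=\bigcup_{j\in\mathbb{N}}DF|_v^{\,j}(u)$, where $DF|_v^{\,j}$ is the $j$-fold composition of $DF|_v$. Newton's iteration sequence $(\mu_i)_{i\in\mathbb{N}}$ associated with $F$ is $\mu_0=F(\emptyset,\dots,\emptyset)$, $\mu_{i+1}=DF|_{\mu_i}^*(F(\mu_i))$. Let $F_{\mathcal{L}}$ be a polynomial transformation over $\mathcal{L}$, and let $F_{\mathcal{P}}$ be the polynomial transformation over $\mathcal{P}$ given by the same expressions with each coefficient $a\subseteq\Sigma^*$ replaced by $\Pi(a)$ (and with the operations of $\mathcal{P}$). Then $F_{\mathcal{P}}$ induces the map $\Pi\circ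 F_{\mathcal{L}}\circ\Pi^{-1}$. Let $(\nu_i)_{i\in\mathbb{N}}$ and $(\kappa_i)_{i\in\mathbb{N}}$ be Newton's iteration sequences associated with $F_{\mathcal{L}}$ and $F_{\mathcal{P}}$, respectively. Then: 1. $\Pi(\nu_i)=\kappa_i$ for every $i\in\mathbb{N}$. 2. $F_{\mathcal{L}}$ has a least fixpoint $\mu F_{\mathcal{L}}$, and for every $k\ge n$ we have $\kappa_k=\Pi(\mu F_{\mathcal{L}})$ and hence $\Pi(\nu_k)=\Pi(\mu F_{\mathcal{L}})$. -/

import Mathlib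

noncomputable section

namespace NewtonParikh

/-- Polynomial expressions with coefficients in `S` and (noncommuting) variables in `X`, built from
coefficients and variables by combine and extend. Every finite sum of monomials
`a₁ X₁ a₂ ⋯ aₖ Xₖ aₖ₊₁` is such an expression; the empty polynomial is `const 0` and the empty
monomial is `const 1`. Expressions are kept as syntax because the differential of a polynomial is
defined by recursion on the expression that describes it. -/
inductive Poly (S X : Type*) where
  | const (a : S) : Poly S X
  | var (x : X) : Poly S X
  | add (g h : Poly S X) : Poly S X
  | mul (g h : Poly S X) : Poly S X

/-- A polynomial transformation of `X → S`: one polynomial for each variable. -/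
abbrev PolyTransformation (S X : Type*) := X → Poly S X

namespace Poly

variable {S T X : Type*}

/-- The value `f(v)` of a polynomial at a valuation. -/
def eval [Semiring S] : Poly S X → (X → S) → S
  | const a, _ => a
  | var x, v => v x
  | add g h, v => eval g v + eval h v
  | mul g h, v => eval g v * eval h v

open Classical in
/-- The differential `D_x f|_v` with respect to the variable `x`, at the valuation `v`, as a
function of the valuation `w` (so the dual variable `dx` takes the value `w x`). -/
def diffVar [Semiring S] (x : X) : Poly S X → (X → S) → (X → S) → S
  | const _, _, _ => 0
  | var y, _, w => if y = x then w x else 0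
  | add g h, v, w => diffVar x g v w + diffVar x h v w
  | mul g h, v, w => diffVar x g v w * eval h v + eval g v * diffVar x h v w

/-- The full differential `D f|_v = ∑ₓ D_x f|_v`. -/
def diff [Semiring S] [Fintype X] (f : Poly S X) (v w : X → S) : S :=
  ∑ x, diffVar x f v w

/-- Replace every coefficient `a` by `φ a`, keeping the form of the expression. -/
def mapCoeff (φ : S → T) : Poly S X → Poly T X
  | const a => const (φ a)
  | var x => var x
  | add g h => add (mapCoeff φ g) (mapCoeff φ h)
  | mul g h => mul (mapCoeff φ g) (mapCoeff φ h)

end Poly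

namespace PolyTransformation

variable {S X : Type*}

/-- The mapping on valuations induced by a polynomial transformation. -/
def eval [Semiring S] (F : PolyTransformation S X) (v : X → S) : X → S :=
  fun x => (F x).eval v

/-- The differential `DF|_v`, componentwise. -/
def diff [Semiring S] [Fintype X] (F : PolyTransformation S X) (v w : X → S) : X → S :=
  fun x => (F x).diff v w

/-- `DF|_v^*(u) = ⨁_j DF|_v^j(u)`. The semirings considered here are idempotent, with lattice order
the natural order and all suprema, so that the infinite sum is the supremum. -/
def diffStar [Semiring S] [CompleteLattice S] [Fintype X] (F : PolyTransformation S X)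
    (v u : X → S) : X → S :=
  ⨆ j : ℕ, (F.diff v)^[j] u

/-- Newton's iteration sequence: `μ₀ = F(0)` and `μᵢ₊₁ = DF|_{μᵢ}^*(F(μᵢ))`. -/
def newton [Semiring S] [CompleteLattice S] [Fintype X] (F : PolyTransformation S X) :
    ℕ → (X → S)
  | 0 => F.eval 0
  | i + 1 => F.diffStar (newton F i) (F.eval (newton F i))

end PolyTransformation

/-- The semiring of sets of Parikh vectors over the alphabet `α`: addition is union, multiplication
is the elementwise sum of sets of vectors (hence `Multiplicative`, the type of vectors with their
addition written as a product), `0 = ∅`, `1 = {0}`, ordered by inclusion. -/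
abbrev ParikhSemiring (α : Type*) := SetSemiring (Multiplicative (α → ℕ))

section Parikh

variable {α X : Type*} [DecidableEq α]

/-- The Parikh image of a word: the sum of the unit vectors of its letters. -/
def parikhWord (w : List α) : α → ℕ := (w.map fun a => Pi.single a 1).sum

/-- The Parikh image `Π(L)` of a language. -/
def parikh (L : Language α) : ParikhSemiring α :=
  Set.up {z | ∃ w ∈ L, Multiplicative.ofAdd (parikhWord w) = z}

/-- The inverse Parikh image `Π⁻¹(M)`: all words whose Parikh image lies in `M`. -/
def parikhInv (M : ParikhSemiring α) : Language α :=
  {w | Multiplicative.ofAdd (parikhWord w) ∈ M.down}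

/-- The Parikh image of a valuation, variable by variable. -/
def parikhVal (v : X → Language α) : X → ParikhSemiring α := fun x => parikh (v x)

/-- The inverse Parikh image of a valuation, variable by variable. -/
def parikhInvVal (v : X → ParikhSemiring α) : X → Language α := fun x => parikhInv (v x)

/-- The polynomial transformation `F_P` over the Parikh semiring that belongs to the polynomial
transformation `F` over languages: the same expressions, with each coefficient replaced by its
Parikh image. -/
def parikhTransformation (F : PolyTransformation (Language α) X) :
    PolyTransformation (ParikhSemiring α) X :=
  fun x => (F x).mapCoeff parikh

end Parikh

end NewtonParikh

end

/-!
The Parikh image `Π` is a semiring homomorphism that preserves all suprema, with upper adjoint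
`Π⁻¹`, and it is surjective because the alphabet is finite. So it carries evaluation, differentials
and Newton iterates of `F` to those of `parikhTransformation F` (`parikhVal_newton`).

What remains is the convergence of Newton's iteration in `n = |X|` steps over a commutative
semiring whose addition is the supremum and whose multiplication distributes over all suprema. A
derivation tree for a variable is recorded by the multiset of the rules (monomials of `F`) at its
nodes. The product of their coefficients is the yield of the tree, and it does not depend on how the
rules are arranged. The suprema of the yields form a prefixed point (`eval_treeSup_le`), which
bounds every Newton iterate. Conversely, a tree with at most `k` distinct variables has a yield
below the `k`-th iterate (`yield_le_newton`), by induction on `k` and then on the number of nodes: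

* If no immediate subtree of the root contains all variables of the tree, all these subtrees lie
  below the iterate of index `k - 1`, and one more application of `F` covers the root.
* Otherwise, choose such a subtree. From its siblings all pumps (parts of the tree between two
  occurrences of the same variable on a path) are removed and inserted into the chosen subtree,
  where every variable occurs. The siblings become acyclic, so their height is less than `k` and
  they lie below the iterate of index `k - 1`. The chosen subtree lies below the `k`-th iterate by
  induction, and the differential at the iterate of index `k - 1` puts the root on top.

Hence the `k`-th iterate over Parikh vectors is a prefixed point `κ` for `k ≥ n`. Then `Π⁻¹(κ)` is a
prefixed point of `F`, so it lies above the least fixpoint, which gives the missing inclusion.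
-/

namespace NewtonParikh

/-! ### Derivation forests -/

/-- A rule `head → coeff · body`: one monomial of the polynomial that belongs to the variable
`head`. Only the multiset of the variables in the monomial is recorded, as multiplication is
commutative in the semirings where rules are used. -/
structure Rule (S X : Type*) where
  /-- The variable that the rule rewrites. -/
  head : X
  /-- The coefficient of the monomial. -/
  coeff : S
  /-- The variables of the monomial, with multiplicity. -/
  body : Multiset X

section Forest

variable {S X : Type*} {R : Set (Rule S X)}

/-- `Forest R s P`: there is a forest of derivation trees whose roots are labelled by the multiset
`s` of variables and whose nodes are labelled by the multiset `P` of rules from `R`. -/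
inductive Forest (R : Set (Rule S X)) : Multiset X → Multiset (Rule S X) → Prop
  | nil : Forest R 0 0
  | cons {r : Rule S X} {s : Multiset X} {P Q : Multiset (Rule S X)} (hr : r ∈ R)
      (hP : Forest R r.body P) (hQ : Forest R s Q) : Forest R (r.head ::ₘ s) (r ::ₘ (P + Q))

namespace Forest

theorem add {s t : Multiset X} {P Q : Multiset (Rule S X)} (hP : Forest R s P)
    (hQ : Forest R t Q) : Forest R (s + t) (P + Q) := by
  induction hP with
  | nil => simpa using hQ
  | @cons r s P₁ P₂ hr h₁ _ _ ih =>
    have := cons hr h₁ ih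
    rwa [← Multiset.cons_add, ← add_assoc, ← Multiset.cons_add] at this

theorem eq_zero {P : Multiset (Rule S X)} (h : Forest R 0 P) : P = 0 := by
  generalize hs : (0 : Multiset X) = s at h
  cases h with
  | nil => rfl
  | cons => simp at hs

theorem exists_of_cons {x : X} {s : Multiset X} {P : Multiset (Rule S X)}
    (h : Forest R (x ::ₘ s) P) :
    ∃ r ∈ R, r.head = x ∧ ∃ P₁ P₂, P = r ::ₘ (P₁ + P₂) ∧ Forest R r.body P₁ ∧ Forest R s P₂ := by
  generalize hu : x ::ₘ s = u at h
  induction h generalizing s with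
  | nil => simp at hu
  | @cons r t P₁ P₂ hr h₁ h₂ _ ih =>
    rcases Multiset.cons_eq_cons.1 hu with ⟨hx, hs⟩ | ⟨-, t', hs, ht⟩
    · exact ⟨r, hr, hx.symm, P₁, P₂, rfl, h₁, hs ▸ h₂⟩
    · obtain ⟨r', hr', hx', Q₁, Q₂, hP, hQ₁, hQ₂⟩ := ih ht.symm
      refine ⟨r', hr', hx', Q₁, r ::ₘ (P₁ + Q₂), ?_, hQ₁, hs ▸ cons hr h₁ hQ₂⟩
      subst hP
      simp only [← Multiset.singleton_add]
      abel

theorem exists_of_singleton {x : X} {P : Multiset (Rule S X)} (h : Forest R {x} P) :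
    ∃ r ∈ R, r.head = x ∧ ∃ P₁, P = r ::ₘ P₁ ∧ Forest R r.body P₁ := by
  obtain ⟨r, hr, hx, P₁, P₂, hP, h₁, h₂⟩ := exists_of_cons (s := 0) h
  exact ⟨r, hr, hx, P₁, by simpa [h₂.eq_zero] using hP, h₁⟩

theorem singleton {r : Rule S X} {P : Multiset (Rule S X)} (hr : r ∈ R)
    (h : Forest R r.body P) : Forest R {r.head} (r ::ₘ P) := by
  simpa using cons hr h nil

/-- The first tree of a forest can be separated from the others. -/
theorem exists_add_of_cons {x : X} {s : Multiset X} {P : Multiset (Rule S X)}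
    (h : Forest R (x ::ₘ s) P) : ∃ P₁ P₂, P = P₁ + P₂ ∧ Forest R {x} P₁ ∧ Forest R s P₂ := by
  obtain ⟨r, hr, rfl, P₁, P₂, rfl, h₁, h₂⟩ := exists_of_cons h
  exact ⟨r ::ₘ P₁, P₂, by simp, singleton hr h₁, h₂⟩

end Forest

/-- `Q` is a pump at `y` if its rules can be added to every derivation tree with root `y`. The
motivating case: `Q` labels a tree with root `y` one of whose leaves, again labelled `y`, is not
yet rewritten. -/
def IsPump (R : Set (Rule S X)) (y : X) (Q : Multiset (Rule S X)) : Prop :=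
  ∀ T, Forest R {y} T → Forest R {y} (T + Q)

/-- `PumpSum R V Q`: the multiset `Q` is a sum of pumps at variables in `V`. -/
inductive PumpSum (R : Set (Rule S X)) (V : Finset X) : Multiset (Rule S X) → Prop
  | zero : PumpSum R V 0
  | add {y : X} {P Q : Multiset (Rule S X)} (hy : y ∈ V) (hQ : IsPump R y Q)
      (hP : PumpSum R V P) : PumpSum R V (P + Q)

theorem PumpSum.sum {V : Finset X} {P Q : Multiset (Rule S X)} (hP : PumpSum R V P)
    (hQ : PumpSum R V Q) : PumpSum R V (P + Q) := by
  induction hQ with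
  | zero => simpa using hP
  | add hy hQ _ ih => rw [← add_assoc]; exact .add hy hQ ih

/-- A pump at `y` can be inserted wherever a node of a forest is labelled by `y`. -/
theorem Forest.add_isPump {s : Multiset X} {P Q : Multiset (Rule S X)} {y : X}
    (hQ : IsPump R y Q) (hP : Forest R s P) (hy : y ∈ P.map Rule.head) : Forest R s (P + Q) := by
  induction hP with
  | nil => simp at hy
  | @cons r s P₁ P₂ hr h₁ h₂ ih₁ ih₂ =>
    rw [Multiset.map_cons, Multiset.mem_cons, Multiset.map_add, Multiset.mem_add] at hy
    rcases hy with rfl | hy | hy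
    · have := (hQ _ (singleton hr h₁)).add h₂
      rw [Multiset.singleton_add] at this
      convert this using 1
      simp only [← Multiset.singleton_add]
      abel
    · convert cons hr (ih₁ hy) h₂ using 1
      simp only [← Multiset.singleton_add]
      abel
    · convert cons hr h₁ (ih₂ hy) using 1
      simp only [← Multiset.singleton_add]
      abel

theorem Forest.add_pumpSum {V : Finset X} {s : Multiset X} {P Q : Multiset (Rule S X)}
    (hQ : PumpSum R V Q) (hP : Forest R s P) (hV : ∀ y ∈ V, y ∈ P.map Rule.head) :
    Forest R s (P + Q) := by
  induction hQ with
  | zero => simpa using hP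
  | add hy hQ _ ih =>
    rw [← add_assoc]
    refine ih.add_isPump hQ ?_
    rw [Multiset.map_add, Multiset.mem_add]
    exact .inl (hV _ hy)

/-! ### Acyclic forests and the removal of pumps -/

section Acyclic

variable [DecidableEq X]

/-- Derivation forests in which no variable repeats on a path from a root to a leaf, and all
variables belong to `U`. -/
inductive AcyclicForest (R : Set (Rule S X)) :
    Finset X → Multiset X → Multiset (Rule S X) → Prop
  | nil {U : Finset X} : AcyclicForest R U 0 0
  | cons {U : Finset X} {r : Rule S X} {s : Multiset X} {P Q : Multiset (Rule S X)} (hr : r ∈ R)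
      (hU : r.head ∈ U) (hP : AcyclicForest R (U.erase r.head) r.body P)
      (hQ : AcyclicForest R U s Q) : AcyclicForest R U (r.head ::ₘ s) (r ::ₘ (P + Q))

namespace AcyclicForest

theorem mono {U V : Finset X} {s : Multiset X} {P : Multiset (Rule S X)}
    (h : AcyclicForest R U s P) (hUV : U ⊆ V) : AcyclicForest R V s P := by
  induction h generalizing V with
  | nil => exact nil
  | cons hr hU _ _ ih₁ ih₂ =>
    exact cons hr (hUV hU) (ih₁ (Finset.erase_subset_erase _ hUV)) (ih₂ hUV)

theorem forest {U : Finset X} {s : Multiset X} {P : Multiset (Rule S X)}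
    (h : AcyclicForest R U s P) : Forest R s P := by
  induction h with
  | nil => exact .nil
  | cons hr _ _ _ ih₁ ih₂ => exact .cons hr ih₁ ih₂

theorem add {U : Finset X} {s t : Multiset X} {P Q : Multiset (Rule S X)}
    (hP : AcyclicForest R U s P) (hQ : AcyclicForest R U t Q) :
    AcyclicForest R U (s + t) (P + Q) := by
  induction hP with
  | nil => simpa using hQ
  | cons hr hU h₁ _ _ ih =>
    have := cons hr hU h₁ (ih hQ)
    rwa [← Multiset.cons_add, ← add_assoc, ← Multiset.cons_add] at this

/-- An acyclic forest either avoids `y`, or has a subtree with root `y` in whose place any other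
derivation tree with root `y` can be put. -/
theorem erase_or_exists {U : Finset X} {s : Multiset X} {P : Multiset (Rule S X)}
    (h : AcyclicForest R U s P) (y : X) :
    AcyclicForest R (U.erase y) s P ∨
      ∃ Q P', P = Q + P' ∧ AcyclicForest R U {y} P' ∧
        ∀ T, Forest R {y} T → Forest R s (Q + T) := by
  induction h with
  | nil => exact .inl nil
  | @cons U r s P₁ P₂ hr hU h₁ h₂ ih₁ ih₂ =>
    by_cases hy : r.head = y
    · subst hy
      refine .inr ⟨P₂, r ::ₘ P₁, ?_, ?_, fun T hT => ?_⟩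
      · simp only [← Multiset.singleton_add]
        abel
      · simpa using cons hr hU h₁ nil
      · rw [add_comm, ← Multiset.singleton_add]
        exact hT.add h₂.forest
    · rcases ih₁ with ih₁ | ⟨Q, P', rfl, hP', hQ⟩
      · rcases ih₂ with ih₂ | ⟨Q, P', rfl, hP', hQ⟩
        · rw [Finset.erase_right_comm] at ih₁
          exact .inl (cons hr (Finset.mem_erase.2 ⟨hy, hU⟩) ih₁ ih₂)
        · refine .inr ⟨r ::ₘ (P₁ + Q), P', ?_, hP', fun T hT => ?_⟩
          · simp only [← Multiset.singleton_add]
            abel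
          · rw [Multiset.cons_add, add_assoc]
            exact .cons hr h₁.forest (hQ T hT)
      · refine .inr ⟨r ::ₘ (Q + P₂), P', ?_, hP'.mono (Finset.erase_subset _ _), fun T hT => ?_⟩
        · simp only [← Multiset.singleton_add]
          abel
        · rw [Multiset.cons_add, add_right_comm]
          exact .cons hr (hQ T hT) h₂.forest

end AcyclicForest

/-- Every derivation forest is, up to rearrangement of its rules, an acyclic forest together with
pumps. Bottom-up: when a node is put on top of acyclic trees that contain its variable again, the
lower occurrence replaces the node and what lies between is a pump. -/
theorem Forest.exists_acyclicForest_add_pumpSum {V : Finset X} {s : Multiset X}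
    {P : Multiset (Rule S X)} (h : Forest R s P) (hV : ∀ y ∈ P.map Rule.head, y ∈ V) :
    ∃ P' P'', P = P' + P'' ∧ AcyclicForest R V s P' ∧ PumpSum R V P'' := by
  induction h with
  | nil => exact ⟨0, 0, by simp, .nil, .zero⟩
  | @cons r s P₁ P₂ hr h₁ h₂ ih₁ ih₂ =>
    simp only [Multiset.map_cons, Multiset.mem_cons, Multiset.map_add, Multiset.mem_add] at hV
    obtain ⟨A₁, B₁, rfl, hA₁, hB₁⟩ := ih₁ fun y hy => hV y (.inr (.inl hy))
    obtain ⟨A₂, B₂, rfl, hA₂, hB₂⟩ := ih₂ fun y hy => hV y (.inr (.inr hy))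
    have hrV : r.head ∈ V := hV _ (.inl rfl)
    rcases hA₁.erase_or_exists r.head with hA | ⟨Q, A, rfl, hA, hQ⟩
    · refine ⟨r ::ₘ (A₁ + A₂), B₁ + B₂, ?_, .cons hr hrV hA hA₂, hB₁.sum hB₂⟩
      simp only [← Multiset.singleton_add]
      abel
    · -- `r` on top of the context `Q` leads from `r.head` down to `r.head` again.
      have hpump : IsPump R r.head (r ::ₘ Q) := fun T hT => by
        have := singleton hr (hQ T hT)
        rwa [add_comm Q, ← Multiset.add_cons] at this
      refine ⟨A + A₂, B₁ + B₂ + r ::ₘ Q, ?_, ?_, .add hrV hpump (hB₁.sum hB₂)⟩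
      · simp only [← Multiset.singleton_add]
        abel
      · rw [← Multiset.singleton_add]
        exact hA.add hA₂

end Acyclic

end Forest

/-! ### Polynomials over idempotent semirings with all suprema -/

/-- A semiring whose addition is the binary supremum of a complete lattice and whose multiplication
distributes over all suprema. -/
class IsSupSemiring (S : Type*) [Semiring S] [CompleteLattice S] : Prop extends IsQuantale S where
  add_eq_sup (a b : S) : a + b = a ⊔ b

section SupSemiring

variable {S X : Type*} [Semiring S] [CompleteLattice S]

theorem PolyTransformation.eval_newton_le_newton_succ [Fintype X]
    (F : PolyTransformation S X) (i : ℕ) : F.eval (F.newton i) ≤ F.newton (i + 1) :=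
  le_iSup (fun j => (F.diff (F.newton i))^[j] (F.eval (F.newton i))) 0

variable [IsSupSemiring S]

namespace IsSupSemiring

protected theorem le_add_left (a b : S) : a ≤ b + a := by
  rw [add_eq_sup]; exact le_sup_right

protected theorem le_add_right (a b : S) : a ≤ a + b := by
  rw [add_eq_sup]; exact le_sup_left

protected theorem add_le {a b c : S} (ha : a ≤ c) (hb : b ≤ c) : a + b ≤ c := by
  rw [add_eq_sup]; exact sup_le ha hb

protected theorem zero_le (a : S) : 0 ≤ a := by
  simpa using IsSupSemiring.le_add_right 0 a

protected theorem sum_le {ι : Type*} {s : Finset ι} {f : ι → S} {b : S} (h : ∀ i ∈ s, f i ≤ b) :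
    ∑ i ∈ s, f i ≤ b := by
  classical
  induction s using Finset.induction_on with
  | empty => simpa using IsSupSemiring.zero_le b
  | insert i s hi ih =>
    rw [Finset.sum_insert hi]
    exact IsSupSemiring.add_le (h i (by simp)) (ih fun j hj => h j (by simp [hj]))

end IsSupSemiring

theorem Poly.eval_mono (f : Poly S X) {v w : X → S} (h : v ≤ w) : f.eval v ≤ f.eval w := by
  induction f with
  | const a => exact le_rfl
  | var x => exact h x
  | add g k ihg ihk =>
    exact IsSupSemiring.add_le (ihg.trans (IsSupSemiring.le_add_right _ _))
      (ihk.trans (IsSupSemiring.le_add_left _ _))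
  | mul g k ihg ihk => exact mul_le_mul' ihg ihk

theorem PolyTransformation.eval_mono (F : PolyTransformation S X) : Monotone F.eval :=
  fun _ _ h x => (F x).eval_mono h

/-- The differential is a sum of monomials of the polynomial in which one variable is evaluated
at `w` and the others at `v`. -/
theorem Poly.diff_le_eval [Fintype X] (f : Poly S X) {v w u : X → S} (hv : v ≤ u) (hw : w ≤ u) :
    f.diff v w ≤ f.eval u := by
  refine IsSupSemiring.sum_le fun x _ => ?_
  induction f with
  | const a => exact IsSupSemiring.zero_le _
  | var y =>
    by_cases h : y = x
    · subst h
      simpa [diffVar, eval] using hw y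
    · simpa [diffVar, h] using IsSupSemiring.zero_le _
  | add g k ihg ihk =>
    exact IsSupSemiring.add_le (ihg.trans (IsSupSemiring.le_add_right _ _))
      (ihk.trans (IsSupSemiring.le_add_left _ _))
  | mul g k ihg ihk =>
    exact IsSupSemiring.add_le (mul_le_mul' ihg (k.eval_mono hv))
      (mul_le_mul' (g.eval_mono hv) ihk)

namespace PolyTransformation

variable [Fintype X] (F : PolyTransformation S X)

theorem diff_le_eval {v w u : X → S} (hv : v ≤ u) (hw : w ≤ u) : F.diff v w ≤ F.eval u :=
  fun x => (F x).diff_le_eval hv hw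

theorem diffStar_le {v u b : X → S} (hv : v ≤ b) (hu : u ≤ b) (hb : F.eval b ≤ b) :
    F.diffStar v u ≤ b := by
  refine iSup_le fun j => ?_
  induction j with
  | zero => exact hu
  | succ j ih =>
    rw [Function.iterate_succ_apply']
    exact (F.diff_le_eval hv ih).trans hb

theorem newton_le {b : X → S} (hb : F.eval b ≤ b) (i : ℕ) : F.newton i ≤ b := by
  induction i with
  | zero => exact (F.eval_mono fun x => IsSupSemiring.zero_le _).trans hb
  | succ i ih => exact F.diffStar_le ih ((F.eval_mono ih).trans hb) hb

theorem newton_le_eval_newton (i : ℕ) : F.newton i ≤ F.eval (F.newton i) := by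
  induction i with
  | zero => exact F.eval_mono fun x => IsSupSemiring.zero_le _
  | succ i ih =>
    have hle := ih.trans (F.eval_newton_le_newton_succ i)
    refine iSup_le fun j => ?_
    cases j with
    | zero => exact F.eval_mono hle
    | succ j =>
      rw [Function.iterate_succ_apply']
      exact F.diff_le_eval hle
        (le_iSup (fun j => (F.diff (F.newton i))^[j] (F.eval (F.newton i))) j)

end PolyTransformation

end SupSemiring

/-! ### Monomials and yields over a commutative semiring -/

section Commutative

variable {S X : Type*} [CommSemiring S]

/-- The monomials of a polynomial, as coefficients with multisets of variables. -/
def Poly.monomials : Poly S X → Multiset (S × Multiset X)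
  | const a => {(a, 0)}
  | var x => {(1, {x})}
  | add g h => monomials g + monomials h
  | mul g h => (monomials g).bind fun p => (monomials h).map fun q => (p.1 * q.1, p.2 + q.2)

theorem Poly.eval_eq_sum_monomials (f : Poly S X) (v : X → S) :
    f.eval v = (f.monomials.map fun p => p.1 * (p.2.map v).prod).sum := by
  induction f with
  | const a => simp [monomials, eval]
  | var x => simp [monomials, eval]
  | add g h ihg ihh => simp [monomials, eval, ihg, ihh]
  | mul g h ihg ihh =>
    have key (p q : S × Multiset X) :
        p.1 * q.1 * ((p.2.map v).prod * (q.2.map v).prod) =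
          p.1 * (p.2.map v).prod * (q.1 * (q.2.map v).prod) := mul_mul_mul_comm _ _ _ _
    simp only [eval, monomials, ihg, ihh, Multiset.map_bind, Multiset.sum_bind, Multiset.map_map,
      Function.comp_def, Multiset.map_add, Multiset.prod_add, key,
      Multiset.sum_map_mul_left, Multiset.sum_map_mul_right]

/-- The value of a multiset of rules: the product of the coefficients. -/
def yield (P : Multiset (Rule S X)) : S := (P.map Rule.coeff).prod

theorem yield_cons (r : Rule S X) (P : Multiset (Rule S X)) :
    yield (r ::ₘ P) = r.coeff * yield P := by simp [yield]

theorem yield_add (P Q : Multiset (Rule S X)) : yield (P + Q) = yield P * yield Q := by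
  simp [yield]

variable [CompleteLattice S] [IsSupSemiring S]

theorem Poly.monomial_le_eval {f : Poly S X} {c : S} {s : Multiset X}
    (h : (c, s) ∈ f.monomials) (v : X → S) : c * (s.map v).prod ≤ f.eval v := by
  rw [eval_eq_sum_monomials]
  obtain ⟨t, ht⟩ := Multiset.exists_cons_of_mem h
  rw [ht, Multiset.map_cons, Multiset.sum_cons]
  exact IsSupSemiring.le_add_right _ _

theorem Poly.eval_le {f : Poly S X} {v : X → S} {b : S}
    (h : ∀ c s, (c, s) ∈ f.monomials → c * (s.map v).prod ≤ b) : f.eval v ≤ b := by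
  rw [eval_eq_sum_monomials]
  generalize f.monomials = M at h
  induction M using Multiset.induction_on with
  | empty => simpa using IsSupSemiring.zero_le b
  | cons p M ih =>
    rw [Multiset.map_cons, Multiset.sum_cons]
    exact IsSupSemiring.add_le (h _ _ (by simp)) (ih fun c s hs => h c s (by simp [hs]))

theorem Poly.monomial_le_diff [Fintype X] {f : Poly S X} {c : S} {x : X} {s : Multiset X}
    (h : (c, x ::ₘ s) ∈ f.monomials) (v w : X → S) :
    c * (w x * (s.map v).prod) ≤ f.diff v w := by
  induction f generalizing c s with
  | const a => simp [monomials] at h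
  | var y =>
    simp only [monomials, Multiset.mem_singleton, Prod.mk.injEq] at h
    obtain ⟨rfl, h⟩ := h
    have hs : s = 0 := by simpa using congrArg Multiset.card h
    subst hs
    have hxy : x = y := by simpa using h
    subst hxy
    simp only [diff, diffVar]
    rw [Finset.sum_eq_single x (fun z _ hz => if_neg hz.symm) (by simp)]
    simp
  | add g k ihg ihk =>
    simp only [diff, diffVar, Finset.sum_add_distrib]
    rcases Multiset.mem_add.1 h with h | h
    · exact (ihg h).trans (IsSupSemiring.le_add_right _ _)
    · exact (ihk h).trans (IsSupSemiring.le_add_left _ _)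
  | mul g k ihg ihk =>
    simp only [diff, diffVar, Finset.sum_add_distrib, ← Finset.sum_mul, ← Finset.mul_sum]
    simp only [monomials, Multiset.mem_bind, Multiset.mem_map, Prod.mk.injEq] at h
    obtain ⟨⟨c₁, s₁⟩, h₁, ⟨c₂, s₂⟩, h₂, rfl, hs⟩ := h
    rcases Multiset.mem_add.1 (hs ▸ Multiset.mem_cons_self x s) with hx | hx
    · obtain ⟨t, rfl⟩ := Multiset.exists_cons_of_mem hx
      rw [Multiset.cons_add, Multiset.cons_inj_right] at hs
      subst hs
      refine le_trans (le_of_eq ?_)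
        ((mul_le_mul' (ihg h₁) (monomial_le_eval h₂ v)).trans (IsSupSemiring.le_add_right _ _))
      rw [Multiset.map_add, Multiset.prod_add]
      ring
    · obtain ⟨t, rfl⟩ := Multiset.exists_cons_of_mem hx
      rw [Multiset.add_cons, Multiset.cons_inj_right] at hs
      subst hs
      refine le_trans (le_of_eq ?_)
        ((mul_le_mul' (monomial_le_eval h₁ v) (ihk h₂)).trans (IsSupSemiring.le_add_left _ _))
      rw [Multiset.map_add, Multiset.prod_add]
      ring

/-- Either no tree of the forest contains all variables of `V`, so that every tree obeys the bound
`v`, or some tree does. -/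
theorem yield_le_or_exists [DecidableEq X] {R : Set (Rule S X)} {V : Finset X} {v : X → S}
    (hv : ∀ x P, Forest R {x} P → (P.map Rule.head).toFinset ⊂ V → yield P ≤ v x)
    (s : Multiset X) {P : Multiset (Rule S X)} (h : Forest R s P)
    (hP : (P.map Rule.head).toFinset ⊆ V) :
    yield P ≤ (s.map v).prod ∨ ∃ x t P₁ P₂, s = x ::ₘ t ∧ P = P₁ + P₂ ∧ Forest R {x} P₁ ∧
      Forest R t P₂ ∧ (P₁.map Rule.head).toFinset = V := by
  induction s using Multiset.induction_on generalizing P with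
  | empty =>
    rw [h.eq_zero]
    exact .inl (by simp [yield])
  | cons x s ih =>
    obtain ⟨P₁, P₂, rfl, h₁, h₂⟩ := h.exists_add_of_cons
    rw [Multiset.map_add, Multiset.toFinset_add, Finset.union_subset_iff] at hP
    by_cases heq : (P₁.map Rule.head).toFinset = V
    · exact .inr ⟨x, s, P₁, P₂, rfl, rfl, h₁, h₂, heq⟩
    · have hlt := hv x P₁ h₁ (hP.1.ssubset_of_ne heq)
      rcases ih h₂ hP.2 with hle | ⟨y, t, Q₁, Q₂, rfl, rfl, hQ₁, hQ₂, hV⟩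
      · left
        rw [yield_add, Multiset.map_cons, Multiset.prod_cons]
        exact mul_le_mul' hlt hle
      · refine .inr ⟨y, x ::ₘ t, Q₁, P₁ + Q₂, Multiset.cons_swap _ _ _, by abel, hQ₁, ?_, hV⟩
        rw [← Multiset.singleton_add]
        exact h₁.add hQ₂

namespace PolyTransformation

/-- The rules of a polynomial transformation: the monomials of its components. -/
def rules (F : PolyTransformation S X) : Set (Rule S X) :=
  {r | (r.coeff, r.body) ∈ (F r.head).monomials}

/-- The supremum of the yields of the derivation trees with root `x`. -/
def treeSup (F : PolyTransformation S X) (x : X) : S :=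
  ⨆ P : {P // Forest F.rules {x} P}, yield P.1

theorem prod_treeSup_le (F : PolyTransformation S X) (s : Multiset X) :
    (s.map F.treeSup).prod ≤ ⨆ P : {P // Forest F.rules s P}, yield P.1 := by
  induction s using Multiset.induction_on with
  | empty => exact le_iSup_of_le ⟨0, .nil⟩ (by simp [yield])
  | cons x s ih =>
    rw [Multiset.map_cons, Multiset.prod_cons]
    refine (mul_le_mul_right ih _).trans ?_
    rw [treeSup, Quantale.iSup_mul_distrib]
    refine iSup_le fun P => ?_
    rw [Quantale.mul_iSup_distrib]
    refine iSup_le fun Q => ?_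
    refine le_iSup_of_le ⟨P.1 + Q.1, ?_⟩ (yield_add _ _).ge
    rw [← Multiset.singleton_add]
    exact P.2.add Q.2

theorem eval_treeSup_le (F : PolyTransformation S X) : F.eval F.treeSup ≤ F.treeSup := by
  intro x
  refine Poly.eval_le fun c s h => ?_
  refine (mul_le_mul_right (F.prod_treeSup_le s) _).trans ?_
  rw [Quantale.mul_iSup_distrib]
  refine iSup_le fun P => ?_
  let r : Rule S X := ⟨x, c, s⟩
  exact le_iSup_of_le ⟨r ::ₘ P.1, Forest.singleton (r := r) h P.2⟩ (yield_cons r _).ge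

variable [Fintype X] (F : PolyTransformation S X)

/-- A rule applied to iterates of index `i`, except for one variable that is already derived at
index `i + 1`, gives a value below the iterate of index `i + 1`. -/
theorem mul_newton_succ_le {r : Rule S X} (hr : r ∈ F.rules) {x : X} {s : Multiset X}
    (hs : r.body = x ::ₘ s) (i : ℕ) :
    r.coeff * (F.newton (i + 1) x * (s.map (F.newton i)).prod) ≤ F.newton (i + 1) r.head := by
  -- Each summand `DF^j` of the inner iterate moves to the summand `DF^(j+1)` of the outer one.
  have key : F.newton (i + 1) x =
      ⨆ j, (F.diff (F.newton i))^[j] (F.eval (F.newton i)) x := by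
    simp only [newton, diffStar, iSup_apply]
  rw [key, Quantale.iSup_mul_distrib, Quantale.mul_iSup_distrib]
  refine iSup_le fun j => ?_
  refine (Poly.monomial_le_diff (f := F r.head) (hs ▸ hr) _ _).trans ?_
  have := le_iSup (fun j => (F.diff (F.newton i))^[j] (F.eval (F.newton i))) (j + 1) r.head
  rwa [Function.iterate_succ_apply'] at this

theorem mul_prod_newton_le {r : Rule S X} (hr : r ∈ F.rules) (i : ℕ) :
    r.coeff * (r.body.map (F.newton i)).prod ≤ F.newton (i + 1) r.head :=
  (Poly.monomial_le_eval hr _).trans (F.eval_newton_le_newton_succ i r.head)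

/-- Acyclic forests over `i + 1` variables have height at most `i`, hence are covered by the
`i`-th Newton iterate. -/
theorem yield_le_of_acyclicForest [DecidableEq X] {U : Finset X} {s : Multiset X}
    {P : Multiset (Rule S X)} (h : AcyclicForest F.rules U s P) {i : ℕ} (hU : U.card ≤ i + 1) :
    yield P ≤ (s.map (F.newton i)).prod := by
  induction h generalizing i with
  | nil => simp [yield]
  | @cons U r s P Q hr hrU hP hQ ih₁ ih₂ =>
    rw [yield_cons, yield_add, Multiset.map_cons, Multiset.prod_cons, ← mul_assoc]
    refine mul_le_mul' ?_ (ih₂ hU)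
    have hcard := Finset.card_erase_of_mem hrU
    cases i with
    | zero =>
      -- No variable is left for the body, so the rule is a constant monomial of `F`.
      have hempty : U.erase r.head = ∅ := Finset.card_eq_zero.1 (by omega)
      rw [hempty] at hP
      generalize hs : r.body = t at hP
      cases hP with
      | nil =>
        have := Poly.monomial_le_eval hr (0 : X → S)
        rw [hs] at this
        simpa [yield, newton, eval] using this
      | cons _ hU' => simp at hU'
    | succ i =>
      exact (mul_le_mul_right (ih₁ (by omega)) _).trans (F.mul_prod_newton_le hr i)

/-- A derivation tree with at most `k` variables is covered by the `k`-th Newton iterate. If no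
immediate subtree of the root contains all variables, these subtrees are covered by the iterate
before. Otherwise one of them that does absorbs all pumps of the remaining ones, which become
acyclic and so are covered by the iterate before, while the enlarged subtree still has fewer nodes
than the whole tree. -/
theorem yield_le_newton (k : ℕ) : ∀ (x : X) (P : Multiset (Rule S X)), Forest F.rules {x} P →
    ∀ V : Finset X, (∀ y, y ∈ V ↔ y ∈ P.map Rule.head) → V.card ≤ k → yield P ≤ F.newton k x := by
  classical
  induction k with
  | zero =>
    intro x P h V hV hcard
    obtain ⟨r, -, -, P, rfl, -⟩ := h.exists_of_singleton
    have : r.head ∈ V := by simp [hV]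
    rw [Finset.card_eq_zero.1 (Nat.le_zero.1 hcard)] at this
    simp at this
  | succ k ihk =>
    intro x P
    induction hN : P.card using Nat.strong_induction_on generalizing x P with
    | _ N ih =>
    intro h V hV hcard
    subst hN
    obtain ⟨r, hr, rfl, P, rfl, hP⟩ := h.exists_of_singleton
    have hPV : (P.map Rule.head).toFinset ⊆ V := fun y hy => by
      rw [hV, Multiset.map_cons, Multiset.mem_cons]
      exact .inr (Multiset.mem_toFinset.1 hy)
    have hsmall : ∀ y Q, Forest F.rules {y} Q → (Q.map Rule.head).toFinset ⊂ V →
        yield Q ≤ F.newton k y := fun y Q hQ hlt =>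
      ihk y Q hQ _ (fun z => Multiset.mem_toFinset)
        (by have := Finset.card_lt_card hlt; omega)
    rw [yield_cons]
    rcases yield_le_or_exists hsmall r.body hP hPV with
      hle | ⟨y, s, P₁, P₂, hs, rfl, h₁, h₂, hV₁⟩
    · exact (mul_le_mul_right hle _).trans (F.mul_prod_newton_le hr k)
    · obtain ⟨A, B, rfl, hA, hB⟩ := h₂.exists_acyclicForest_add_pumpSum (V := V) fun z hz => by
        rw [hV, Multiset.map_cons, Multiset.mem_cons, Multiset.map_add, Multiset.mem_add]
        exact .inr (.inr hz)
      have hV₁' : ∀ z ∈ V, z ∈ P₁.map Rule.head := fun z hz => by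
        rwa [← hV₁, Multiset.mem_toFinset] at hz
      -- The pumps add no new variables, and the enlarged subtree lacks the root of the whole tree.
      have hbig : yield (P₁ + B) ≤ F.newton (k + 1) y := by
        refine ih _ ?_ y (P₁ + B) rfl (h₁.add_pumpSum hB hV₁') V (fun z => ?_) hcard
        · simp only [Multiset.card_cons, Multiset.card_add]
          omega
        · rw [Multiset.map_add, Multiset.mem_add]
          refine ⟨fun hz => .inl (hV₁' z hz), fun hz => ?_⟩
          rw [hV, Multiset.map_cons, Multiset.mem_cons, Multiset.map_add, Multiset.map_add,
            Multiset.mem_add, Multiset.mem_add]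
          tauto
      have hside := F.yield_le_of_acyclicForest hA hcard
      calc r.coeff * yield (P₁ + (A + B)) = r.coeff * (yield (P₁ + B) * yield A) := by
            simp only [yield_add]; ring
        _ ≤ r.coeff * (F.newton (k + 1) y * (s.map (F.newton k)).prod) :=
            mul_le_mul_right (mul_le_mul' hbig hside) _
        _ ≤ F.newton (k + 1) r.head := F.mul_newton_succ_le hr hs k

theorem newton_eq_treeSup {k : ℕ} (hk : Fintype.card X ≤ k) : F.newton k = F.treeSup := by
  classical
  refine le_antisymm (F.newton_le F.eval_treeSup_le k) fun x => iSup_le fun P => ?_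
  exact F.yield_le_newton k x P.1 P.2 (P.1.map Rule.head).toFinset
    (fun y => Multiset.mem_toFinset) ((Finset.card_le_univ _).trans hk)

theorem eval_newton_le {k : ℕ} (hk : Fintype.card X ≤ k) :
    F.eval (F.newton k) ≤ F.newton k := by
  rw [F.newton_eq_treeSup hk]
  exact F.eval_treeSup_le

end PolyTransformation

end Commutative
/-! ### The Parikh image as a homomorphism -/

instance {M : Type*} [CommMonoid M] : IsSupSemiring (SetSemiring M) where
  mul_sSup_distrib x s := by
    rw [sSup_eq_iSup]
    exact Set.mul_iUnion₂ x.down fun y (_ : y ∈ s) => y.down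
  sSup_mul_distrib s x := by
    rw [sSup_eq_iSup]
    exact Set.iUnion₂_mul (fun y (_ : y ∈ s) => y.down) x.down
  add_eq_sup _ _ := rfl

instance {α : Type*} : IsSupSemiring (Language α) where
  mul_sSup_distrib x s := by
    rw [sSup_eq_iSup]
    simp only [Language.mul_iSup]
  sSup_mul_distrib s x := by
    rw [sSup_eq_iSup]
    simp only [Language.iSup_mul]
  add_eq_sup _ _ := rfl

variable {α X : Type*} [DecidableEq α]

theorem parikhWord_append (u v : List α) : parikhWord (u ++ v) = parikhWord u + parikhWord v := by
  simp [parikhWord]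

theorem parikhWord_surjective [Fintype α] : Function.Surjective (parikhWord (α := α)) := by
  intro z
  refine ⟨(Finset.univ.toList.map fun a => List.replicate (z a) a).flatten, ?_⟩
  have h : ∀ l : List α, parikhWord (l.map fun a => List.replicate (z a) a).flatten =
      (l.map fun a => Pi.single a (z a)).sum := by
    intro l
    induction l with
    | nil => simp [parikhWord]
    | cons a l ih =>
      rw [List.map_cons, List.flatten_cons, parikhWord_append, ih, List.map_cons, List.sum_cons]
      congr 1
      rw [parikhWord, List.map_replicate, List.sum_replicate, ← Pi.single_smul]
      simp
  rw [h, Finset.sum_map_toList, Finset.univ_sum_single]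

theorem parikh_le_iff {L : Language α} {M : ParikhSemiring α} : parikh L ≤ M ↔ L ≤ parikhInv M :=
  ⟨fun h w hw => h ⟨w, hw, rfl⟩, fun h _ ⟨_, hw, hz⟩ => hz ▸ h hw⟩

theorem parikh_gc : GaloisConnection (parikh (α := α)) parikhInv := fun _ _ => parikh_le_iff

theorem parikh_parikhInv [Fintype α] (M : ParikhSemiring α) : parikh (parikhInv M) = M := by
  refine le_antisymm (parikh_gc.l_u_le M) fun z hz => ?_
  obtain ⟨w, hw⟩ := parikhWord_surjective z.toAdd
  refine ⟨w, ?_, congrArg Multiplicative.ofAdd hw⟩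
  change Multiplicative.ofAdd (parikhWord w) ∈ M.down
  rw [hw]
  exact hz

theorem parikh_zero : parikh (0 : Language α) = 0 :=
  parikh_gc.l_bot

theorem parikh_add (K L : Language α) : parikh (K + L) = parikh K + parikh L :=
  parikh_gc.l_sup

theorem parikh_mul (K L : Language α) : parikh (K * L) = parikh K * parikh L := by
  refine le_antisymm ?_ ?_
  · rintro _ ⟨_, ⟨u, hu, v, hv, rfl⟩, rfl⟩
    exact ⟨_, ⟨u, hu, rfl⟩, _, ⟨v, hv, rfl⟩,
      (congrArg Multiplicative.ofAdd (parikhWord_append u v)).symm⟩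
  · rintro _ ⟨_, ⟨u, hu, rfl⟩, _, ⟨v, hv, rfl⟩, rfl⟩
    exact ⟨u ++ v, ⟨u, hu, v, hv, rfl⟩, congrArg Multiplicative.ofAdd (parikhWord_append u v)⟩

theorem parikh_sum {ι : Type*} (s : Finset ι) (f : ι → Language α) :
    parikh (∑ i ∈ s, f i) = ∑ i ∈ s, parikh (f i) := by
  classical
  induction s using Finset.induction_on with
  | empty => exact parikh_zero
  | insert i s hi ih => rw [Finset.sum_insert hi, Finset.sum_insert hi, parikh_add, ih]

theorem parikh_eval (f : Poly (Language α) X) (v : X → Language α) :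
    parikh (f.eval v) = (f.mapCoeff parikh).eval (parikhVal v) := by
  induction f with
  | const a => rfl
  | var x => rfl
  | add g h ihg ihh => simp only [Poly.eval, Poly.mapCoeff, parikh_add, ihg, ihh]
  | mul g h ihg ihh => simp only [Poly.eval, Poly.mapCoeff, parikh_mul, ihg, ihh]

theorem parikh_diffVar (f : Poly (Language α) X) (x : X) (v w : X → Language α) :
    parikh (f.diffVar x v w) = (f.mapCoeff parikh).diffVar x (parikhVal v) (parikhVal w) := by
  induction f with
  | const a => exact parikh_zero
  | var y =>
    simp only [Poly.diffVar, Poly.mapCoeff]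
    split_ifs
    · rfl
    · exact parikh_zero
  | add g h ihg ihh => simp only [Poly.diffVar, Poly.mapCoeff, parikh_add, ihg, ihh]
  | mul g h ihg ihh =>
    simp only [Poly.diffVar, Poly.mapCoeff, parikh_add, parikh_mul, ihg, ihh, parikh_eval]

variable (F : PolyTransformation (Language α) X)

theorem parikhVal_eval (v : X → Language α) :
    parikhVal (F.eval v) = (parikhTransformation F).eval (parikhVal v) :=
  funext fun x => parikh_eval (F x) v

theorem parikhVal_diff [Fintype X] (v w : X → Language α) :
    parikhVal (F.diff v w) = (parikhTransformation F).diff (parikhVal v) (parikhVal w) :=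
  funext fun x => (parikh_sum _ _).trans
    (Finset.sum_congr rfl fun y _ => parikh_diffVar (F x) y v w)

theorem parikhVal_diffStar [Fintype X] (v u : X → Language α) :
    parikhVal (F.diffStar v u) =
      (parikhTransformation F).diffStar (parikhVal v) (parikhVal u) := by
  have hiter (j : ℕ) : parikhVal ((F.diff v)^[j] u) =
      ((parikhTransformation F).diff (parikhVal v))^[j] (parikhVal u) := by
    induction j with
    | zero => rfl
    | succ j ih => rw [Function.iterate_succ_apply', Function.iterate_succ_apply', ← ih,
        parikhVal_diff]
  funext x
  simp only [PolyTransformation.diffStar, ← hiter, iSup_apply, parikhVal]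
  exact parikh_gc.l_iSup

theorem parikhVal_newton [Fintype X] (i : ℕ) :
    parikhVal (F.newton i) = (parikhTransformation F).newton i := by
  induction i with
  | zero =>
    simp only [PolyTransformation.newton, parikhVal_eval]
    congr 1
    exact funext fun x => parikh_zero
  | succ i ih => simp only [PolyTransformation.newton, parikhVal_diffStar, parikhVal_eval, ih]

theorem parikhTransformation_eval [Fintype α] (v : X → ParikhSemiring α) :
    (parikhTransformation F).eval v = parikhVal (F.eval (parikhInvVal v)) := by
  rw [parikhVal_eval]
  congr 1
  exact funext fun x => (parikh_parikhInv (v x)).symm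

/-- The inverse Parikh image of a prefixed point over Parikh vectors is a prefixed point over
languages, which bounds the least fixpoint from above. -/
theorem newton_parikhTransformation_eq [Fintype α] [Fintype X] {μ : X → Language α}
    (hμ : IsLeast {v | F.eval v ≤ v} μ) {k : ℕ} (hk : Fintype.card X ≤ k) :
    (parikhTransformation F).newton k = parikhVal μ := by
  refine le_antisymm ?_ ?_
  · rw [← parikhVal_newton]
    exact fun x => parikh_gc.monotone_l (F.newton_le hμ.1 k x)
  · have hpre : F.eval (parikhInvVal ((parikhTransformation F).newton k)) ≤
        parikhInvVal ((parikhTransformation F).newton k) := fun x => by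
      refine parikh_le_iff.1 ?_
      have := (parikhTransformation F).eval_newton_le hk x
      rwa [parikhTransformation_eval] at this
    exact fun x => parikh_le_iff.2 (hμ.2 hpre x)

end NewtonParikh

theorem mainTheorem2 {α X : Type*} [Fintype α] [DecidableEq α] [Fintype X]
    (F : NewtonParikh.PolyTransformation (Language α) X) :
    -- the transformation over the Parikh semiring induces `Π ∘ F ∘ Π⁻¹`
    (∀ v : X → NewtonParikh.ParikhSemiring α,
      (NewtonParikh.parikhTransformation F).eval v =
        NewtonParikh.parikhVal (F.eval (NewtonParikh.parikhInvVal v))) ∧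
    -- the Parikh images of the iterates are the iterates over the Parikh semiring
    (∀ i : ℕ, NewtonParikh.parikhVal (F.newton i) =
      (NewtonParikh.parikhTransformation F).newton i) ∧
    -- `F` has a least fixpoint, whose Parikh image is reached after `n` steps
    ∃ μF : X → Language α, IsLeast (Function.fixedPoints F.eval) μF ∧
      ∀ k : ℕ, Fintype.card X ≤ k →
        (NewtonParikh.parikhTransformation F).newton k = NewtonParikh.parikhVal μF ∧
        NewtonParikh.parikhVal (F.newton k) = NewtonParikh.parikhVal μF := by
  let f : (X → Language α) →o (X → Language α) := ⟨F.eval, F.eval_mono⟩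
  have hpre : IsLeast {v | F.eval v ≤ v} f.lfp := ⟨f.map_lfp.le, fun _ hv => f.lfp_le hv⟩
  have hnewton {k : ℕ} (hk : Fintype.card X ≤ k) :=
    NewtonParikh.newton_parikhTransformation_eq F hpre hk
  exact ⟨NewtonParikh.parikhTransformation_eval F, NewtonParikh.parikhVal_newton F,
    f.lfp, f.isLeast_lfp,
    fun k hk => ⟨hnewton hk, (NewtonParikh.parikhVal_newton F k).trans (hnewton hk)⟩⟩
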